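/- Let $\mathcal Q$ be the set of prime powers $q=p^n$ ($p$ prime, $n\ge 1$). Let $\mathcal S\subset\mathbb Z[q]$ be the saturated multiplicative system generated by the polynomials $q^n-q$ for $n>1$, and let $\mathsf R=\mathcal S^{-1}\mathbb Z[q]$. Elements of $\mathcal S$ do not vanish on $\mathcal Q$, so $\mathsf R$ acts on functions $\mathcal Q\to\mathbb Q$ by multiplication by values. For a finite simple graph $G$ with vertex set $V$, let $[Z_G]:\mathcal Q\to\mathbb Q$ be the function whose value at $q$ is the number of nondegenerate symmetric $V\times V$ matrices $M$ over $\mathbb F_q$ such that $M_{vw}=0$ whenever $v$ and $w$ are joined by an edge of $G$. For integers $s,r,k\ge 0$ let $[A_G(s,r,k)]:\mathcal Q\to\mathbb Q$ be the function whose value at $q$ is the number of pairs $(Q,f)$ consisting of a symmetric bilinear form $Q$ of rank $r$ on $\mathbb F_q^s$ and a function $f:V\to\mathbb F_q^s$ whose values span a subspace of dimension $k$, such that $Q(f(v),f(w))=0$ whenever $v$ and $w$ are joined by an edge of $G$. Let $M(G)$ be the $\mathsf R$-module spanned by the functions $[A_G(s,r,k)]$ for all $s,r,k\ge 0$, let $DG$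 be the graph obtained from $G$ by adding one disjoint vertex, and let $\mathrm{Graphs}_*$ be the $\mathsf R$-module spanned by the functions $[Z_H]$ for all finite simple graphs $H$. Theorem. For every finite simple graph $G$, $M(G)$ is equal to the $\mathsf R$-module spanned by the functions $[Z_{D^kG}]$ for $k\ge 0$. In particular, $M(G)\subset\mathrm{Graphs}_*$. -/

import Mathlib

universe u

namespace GraphModules

noncomputable section

/-! ### Functions on prime powers and the coefficient ring -/

/-- The set of prime powers `q = p ^ n`, `n ≥ 1`. -/
abbrev PrimePower : Type := {q : ℕ // IsPrimePow q}

instance fact_minFac_prime (q : PrimePower) : Fact q.1.minFac.Prime :=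
  ⟨Nat.minFac_prime q.2.ne_one⟩

/-- The finite field with `q` elements. -/
abbrev Fq (q : PrimePower) : Type :=
  GaloisField q.1.minFac (q.1.factorization q.1.minFac)

theorem card_Fq (q : PrimePower) : Nat.card (Fq q) = q.1 := by
  have h := q.2.minFac_pow_factorization_eq
  rw [GaloisField.card _ _ ?_, h]
  intro h0
  rw [h0, pow_zero] at h
  exact q.2.ne_one h.symm

/-- The ring of functions from the set of prime powers to `ℚ`. -/
abbrev CountFun : Type := PrimePower → ℚ

/-- The saturated multiplicative system in `ℤ[q]` generated by the `q ^ n - q`, `n > 1`. -/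
def S : Submonoid (Polynomial ℤ) :=
  (Submonoid.closure {f : Polynomial ℤ |
    ∃ n : ℕ, 1 < n ∧ f = Polynomial.X ^ n - Polynomial.X}).saturation.toSubmonoid

/-- The ring `R = S⁻¹ ℤ[q]`. -/
abbrev R : Type := Localization S

/-- A polynomial in `ℤ[q]` regarded as a function on prime powers. -/
def evalHom : Polynomial ℤ →+* CountFun :=
  RingHom.pi fun q => Polynomial.eval₂RingHom (Int.castRingHom ℚ) (q.1 : ℚ)

/-- The elements of `S` do not vanish on prime powers. -/
theorem isUnit_evalHom (f : S) : IsUnit (evalHom f) := by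
  obtain ⟨f, hf⟩ := f
  obtain ⟨g, hg⟩ := Submonoid.mem_saturation_iff.mp hf
  have key : ∀ h ∈ Submonoid.closure {f : Polynomial ℤ |
      ∃ n : ℕ, 1 < n ∧ f = Polynomial.X ^ n - Polynomial.X}, IsUnit (evalHom h) := by
    intro h hh
    induction hh using Submonoid.closure_induction with
    | one => simp
    | mul x y _ _ hx hy => rw [map_mul]; exact hx.mul hy
    | mem x hx =>
      obtain ⟨n, hn, rfl⟩ := hx
      rw [Pi.isUnit_iff]
      intro q
      have h1 : (1 : ℚ) < (q.1 : ℚ) := by exact_mod_cast q.2.one_lt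
      have h2 : (q.1 : ℚ) < (q.1 : ℚ) ^ n := by
        simpa using pow_lt_pow_right₀ h1 hn
      have h3 : evalHom (Polynomial.X ^ n - Polynomial.X) q = (q.1 : ℚ) ^ n - q.1 := by
        simp [evalHom]
      rw [h3]
      exact (sub_pos.mpr h2).ne'.isUnit
  have := key _ hg
  rw [map_mul] at this
  exact isUnit_of_mul_isUnit_left this

/-- An element of `R`, regarded as a function on prime powers. -/
def evalR : R →+* CountFun := IsLocalization.lift (M := S) isUnit_evalHom

/-- `R` acts on functions on prime powers by `(a / s • F) q = a(q) / s(q) * F q`. -/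
instance algebraCountFun : Algebra R CountFun := evalR.toAlgebra

/-! ### Graphs and their counting functions -/

/-- A finite simple graph. -/
structure FinSimpleGraph where
  V : Type u
  [fintypeV : Fintype V]
  graph : SimpleGraph V

attribute [instance] FinSimpleGraph.fintypeV

/-- `D G`: the graph obtained from `G` by adding one disjoint vertex. -/
def D (G : FinSimpleGraph.{u}) : FinSimpleGraph.{u} where
  V := Option G.V
  graph := G.graph.map Function.Embedding.some

/-- The `K`-points of `Z_G`: symmetric nondegenerate matrices, with rows and columns indexed by
the vertices of `G`, whose `(v, w)` entry is zero whenever `v` and `w` are joined by an edge. -/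
def ZPoints (G : FinSimpleGraph.{u}) (K : Type) [Field K] : Set (Matrix G.V G.V K) :=
  {M | M.IsSymm ∧ M.rank = Fintype.card G.V ∧ ∀ v w, G.graph.Adj v w → M v w = 0}

/-- The `K`-points of `A_G(s, r, k)`: pairs `(Q, f)` where `Q` is a symmetric bilinear form of
rank `r` on `K ^ s` and `f` is a function from the vertices of `G` to `K ^ s` whose span has
dimension `k`, such that `Q (f v) (f w) = 0` whenever `v` and `w` are joined by an edge. -/
def APoints (G : FinSimpleGraph.{u}) (s r k : ℕ) (K : Type) [Field K] :
    Set (LinearMap.BilinForm K (Fin s → K) × (G.V → Fin s → K)) :=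
  {x | x.1.IsSymm ∧ Module.finrank K (LinearMap.range x.1) = r ∧
    Module.finrank K (Submodule.span K (Set.range x.2)) = k ∧
    ∀ v w, G.graph.Adj v w → x.1 (x.2 v) (x.2 w) = 0}

/-- `[Z_G]`: the function `q ↦ #Z_G(𝔽_q)`. -/
def countZ (G : FinSimpleGraph.{u}) : CountFun :=
  fun q => (Nat.card (ZPoints G (Fq q)) : ℚ)

/-- `[A_G(s, r, k)]`: the function `q ↦ #A_G(s, r, k)(𝔽_q)`. -/
def countA (G : FinSimpleGraph.{u}) (s r k : ℕ) : CountFun :=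
  fun q => (Nat.card (APoints G s r k (Fq q)) : ℚ)

/-- `M(G)`: the `R`-module generated by all the `[A_G(s, r, k)]`. -/
def M (G : FinSimpleGraph.{u}) : Submodule R CountFun :=
  Submodule.span R {F | ∃ s r k : ℕ, F = countA G s r k}

/-- `Graphs_*`: the `R`-module generated by the `[Z_H]` for all finite simple graphs `H`. -/
def GraphsStar : Submodule R CountFun :=
  Submodule.span R (Set.range countZ.{u})

end

end GraphModules

namespace GraphModules

open Polynomial Matrix Module

/-! ### Counting by fibers -/

/-! Let n be the number of vertices and let `countRank G t` count the symmetric matrices of rank t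
that vanish on the edges. Both modules equal the span of these functions for t ≤ n.

For a pair (Q, f), write f as a matrix F with rows f(v). The edge conditions involve only the Gram
matrix P = F Q Fᵀ, and the fibre over P has size a polynomial in q depending only on rank P
(`card_congruence_pairs`). So each [A_G(s,r,k)] is a combination of the `countRank G t`. For s = r =
k = t, the form is nondegenerate and F is injective, so only rank t occurs, with coefficient ∏ (q^t
- q^i), a unit of `R`.

A disjoint vertex means a free symmetric bordering, which raises the rank by 0, 1 or 2 in numbers
depending only on the old rank (`card_rank_border`). So each [Z_{D^k G}] is also such a combination.
Conversely, rank t contributes to rank t + 2 for DG with coefficient q(q^n - q^t), a unit for t < n;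
induction on the corank n - t recovers every `countRank G t` (`countRank_mem_spanZ`). -/

theorem card_eq_sum_card_fiber {α β τ : Type*} [Finite α] [Finite β] (g : α → β) (ρ : β → τ)
    (T : Finset τ) (hρ : ∀ b, ρ b ∈ T) (c : τ → ℚ)
    (h : ∀ b, (Nat.card {a // g a = b} : ℚ) = c (ρ b)) :
    (Nat.card α : ℚ) = ∑ t ∈ T, (Nat.card {b // ρ b = t} : ℚ) * c t := by
  classical
  cases nonempty_fintype α
  cases nonempty_fintype β
  rw [← Nat.card_congr (Equiv.sigmaFiberEquiv g), Nat.card_sigma, Nat.cast_sum]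
  simp_rw [h]
  rw [← Finset.sum_fiberwise_of_maps_to (g := ρ) (t := T) (fun b _ => hρ b)]
  refine Finset.sum_congr rfl fun t _ => ?_
  rw [Finset.sum_congr rfl (g := fun _ => c t) fun b hb => by rw [(Finset.mem_filter.1 hb).2],
    Finset.sum_const, nsmul_eq_mul, Nat.card_eq_fintype_card, Fintype.card_subtype]

theorem natCard_submodule {K E : Type*} [Field K] [Finite K] [AddCommGroup E] [Module K E]
    [FiniteDimensional K E] (U : Submodule K E) :
    Nat.card U = Nat.card K ^ finrank K U :=
  Module.natCard_eq_pow_finrank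

theorem natCard_diff_submodule {K E : Type*} [Field K] [Finite K] [AddCommGroup E] [Module K E]
    [FiniteDimensional K E] {U W : Submodule K E} (h : U ≤ W) :
    (Nat.card {x // x ∈ W ∧ x ∉ U} : ℚ) =
      (Nat.card K : ℚ) ^ finrank K W - (Nat.card K : ℚ) ^ finrank K U := by
  have : Finite E := Module.finite_of_finite K
  have h1 : ((W : Set E) \ U).ncard + (U : Set E).ncard = (W : Set E).ncard :=
    Set.ncard_sdiff_add_ncard_of_subset h
  have h2 := natCard_submodule (K := K) U
  have h3 := natCard_submodule (K := K) W
  change (U : Set E).ncard = _ at h2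
  change (W : Set E).ncard = _ at h3
  rw [h2, h3] at h1
  change ((((W : Set E) \ U).ncard : ℕ) : ℚ) = _
  rw [eq_sub_iff_add_eq]
  exact_mod_cast h1

/-! ### Bordered symmetric matrices -/

section Border

variable {K : Type*} {ι : Type*}

/-- The symmetric bordering of `A` by the vector `b` with corner entry `c`. -/
def border (A : Matrix ι ι K) (b : ι → K) (c : K) : Matrix (Option ι) (Option ι) K
  | some i, some j => A i j
  | some i, none => b i
  | none, some j => b j
  | none, none => c

theorem isSymm_border {A : Matrix ι ι K} (hA : A.IsSymm) (b : ι → K) (c : K) :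
    (border A b c).IsSymm := by
  ext i j
  cases i <;> cases j <;> simp [border, hA.apply]

theorem eq_border {M : Matrix (Option ι) (Option ι) K} (hM : M.IsSymm) :
    M = border (M.submatrix some some) (fun i => M (some i) none) (M none none) := by
  ext i j
  cases i <;> cases j <;> simp [border, hM.apply]

variable [Field K]

open Classical in
theorem rank_option_columns {m n : Type*} [Finite m] [Fintype n] (X : Matrix m (Option n) K) :
    X.rank = (X.submatrix id some).rank +
      if X.col none ∈ Submodule.span K (Set.range (X.submatrix id some).col) then 0 else 1 := by
  have h : Set.range X.col = insert (X.col none) (Set.range (X.submatrix id some).col) := by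
    ext v
    simp only [Set.mem_range, Option.exists, Set.mem_insert_iff]
    exact or_congr eq_comm Iff.rfl
  rw [rank_eq_finrank_span_cols, rank_eq_finrank_span_cols, h]
  split_ifs with hv
  · rw [Submodule.span_insert_eq_span hv, add_zero]
  · rw [Submodule.span_insert, sup_comm, Submodule.finrank_sup_span_singleton hv]

variable [Fintype ι]

theorem mem_span_col_iff {m : Type*} (A : Matrix m ι K) (b : m → K) :
    b ∈ Submodule.span K (Set.range A.col) ↔ ∃ x, A *ᵥ x = b := by
  rw [← range_mulVecLin]
  rfl

-- By symmetry, adjoining the row b to A keeps the rank exactly when b lies in the column space. The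
-- last column (b, c) is then dependent iff Ax = b and b·x = c for some x. Since b·x is the same for
-- all solutions x, exactly one corner c keeps the rank.
open Classical in
theorem exists_rank_border {A : Matrix ι ι K} (hA : A.IsSymm) :
    ∃ φ : (ι → K) → K, ∀ b c, (border A b c).rank =
      if b ∈ Submodule.span K (Set.range A.col) then
        if c = φ b then A.rank else A.rank + 1
      else A.rank + 2 := by
  have h1 : ∀ b c, ((border A b c).submatrix id some).rank = A.rank +
      if b ∈ Submodule.span K (Set.range A.col) then 0 else 1 := by
    intro b c
    rw [← rank_transpose, rank_option_columns]
    have e1 : (((border A b c).submatrix id some)ᵀ.submatrix id some) = A := by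
      ext i j; exact hA.apply i j
    have e2 : ((border A b c).submatrix id some)ᵀ.col none = b := by
      ext i; rfl
    rw [e1, e2]
  have h2 : ∀ b c, (border A b c).col none ∈
      Submodule.span K (Set.range ((border A b c).submatrix id some).col) ↔
      ∃ x, A *ᵥ x = b ∧ b ⬝ᵥ x = c := by
    intro b c
    rw [mem_span_col_iff]
    refine exists_congr fun x => ?_
    rw [funext_iff, Option.forall, funext_iff, and_comm]
    rfl
  refine ⟨fun b => if h : ∃ x, A *ᵥ x = b then b ⬝ᵥ h.choose else 0, fun b c => ?_⟩
  rw [rank_option_columns, h1, h2, mem_span_col_iff]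
  by_cases hb : ∃ x, A *ᵥ x = b
  · have hc : (∃ x, A *ᵥ x = b ∧ b ⬝ᵥ x = c) ↔ c = b ⬝ᵥ hb.choose := by
      constructor
      · rintro ⟨x, hx, rfl⟩
        have h0 := hb.choose_spec
        generalize hb.choose = y at h0
        calc b ⬝ᵥ x = (y ᵥ* A) ⬝ᵥ x := by rw [← h0, ← vecMul_transpose, hA.eq]
          _ = b ⬝ᵥ y := by rw [← dotProduct_mulVec, hx, dotProduct_comm]
      · rintro rfl
        exact ⟨_, hb.choose_spec, rfl⟩
    rw [hc]
    simp only [hb, if_true, dif_pos, add_zero]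
    split_ifs <;> rfl
  · have hc : ¬ ∃ x, A *ᵥ x = b ∧ b ⬝ᵥ x = c := fun ⟨x, hx, _⟩ => hb ⟨x, hx⟩
    simp [hb, hc]

/-- The number of symmetric borderings of rank `r` of a symmetric `n × n` matrix of rank `t`, as a
polynomial in the number of elements of the field. -/
noncomputable def borderPoly (n t r : ℕ) : ℤ[X] :=
  X ^ t * (if r = t then 1 else if r = t + 1 then X - 1 else 0) +
    (X ^ n - X ^ t) * (if r = t + 2 then X else 0)

/-- The q^t vectors b in the column space each have one corner preserving the rank and q - 1 raising
it by one; for the remaining q^n - q^t vectors all q corners raise it by two. -/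
theorem card_rank_border [Finite K] {A : Matrix ι ι K} (hA : A.IsSymm) (r : ℕ) :
    (Nat.card {x : (ι → K) × K // (border A x.1 x.2).rank = r} : ℚ) =
      aeval (Nat.card K : ℚ) (borderPoly (Fintype.card ι) A.rank r) := by
  classical
  obtain ⟨φ, hφ⟩ := exists_rank_border hA
  set U := Submodule.span K (Set.range A.col) with hU
  have hUr : finrank K U = A.rank := (rank_eq_finrank_span_cols A).symm
  have hq : ∀ a : K, (Nat.card {c : K // c ≠ a} : ℚ) = (Nat.card K : ℚ) - 1 := by
    intro a
    cases nonempty_fintype K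
    have := Set.ncard_sdiff_singleton_add_one (Set.mem_univ a) (Set.toFinite _)
    rw [Set.ncard_univ] at this
    have h2 : Nat.card {c : K // c ≠ a} = (Set.univ \ {a} : Set K).ncard := by
      rw [← Nat.card_coe_set_eq]
      exact Nat.card_congr (Equiv.subtypeEquivRight fun c => by simp)
    rw [h2, ← this]; push_cast; ring
  rw [card_eq_sum_card_fiber (fun x => x.1.1) (fun b => decide (b ∈ U)) Finset.univ
    (fun _ => Finset.mem_univ _)
    (fun z => if z then (if r = A.rank then 1 else if r = A.rank + 1 then (Nat.card K : ℚ) - 1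
      else 0) else if r = A.rank + 2 then (Nat.card K : ℚ) else 0)]
  · rw [Fintype.sum_bool]
    have h1 : (Nat.card {b // decide (b ∈ U) = true} : ℚ) = (Nat.card K : ℚ) ^ A.rank := by
      simp only [decide_eq_true_eq]
      rw [← hUr]
      exact_mod_cast natCard_submodule U
    have h2 : (Nat.card {b // decide (b ∈ U) = false} : ℚ) =
        (Nat.card K : ℚ) ^ Fintype.card ι - (Nat.card K : ℚ) ^ A.rank := by
      have := natCard_diff_submodule (K := K) (le_top : U ≤ ⊤)
      rw [finrank_top, finrank_fintype_fun_eq_card, hUr] at this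
      rw [← this]
      simp
    rw [h1, h2, borderPoly]
    simp only [map_add, map_mul, map_pow, aeval_X, map_sub, apply_ite (aeval (Nat.card K : ℚ)),
      map_one, map_zero, if_true, Bool.false_eq_true, if_false]
  · intro b
    have e : {a : {x : (ι → K) × K // (border A x.1 x.2).rank = r} // a.1.1 = b} ≃
        {c : K // (border A b c).rank = r} :=
      { toFun := fun a => ⟨a.1.1.2, by have := a.1.2; rwa [a.2] at this⟩
        invFun := fun c => ⟨⟨(b, c.1), c.2⟩, rfl⟩
        left_inv := by rintro ⟨⟨⟨b, c⟩, h⟩, rfl⟩; rfl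
        right_inv := fun c => rfl }
    rw [Nat.card_congr e]
    simp_rw [hφ]
    by_cases hb : b ∈ U
    · simp only [hb, if_true, decide_true]
      by_cases h0 : r = A.rank
      · subst h0
        simp
      · by_cases h1 : r = A.rank + 1
        · subst h1
          simpa using hq (φ b)
        · have : ∀ c, ¬ ((if c = φ b then A.rank else A.rank + 1) = r) := by
            intro c; split_ifs <;> omega
          simp [this, h0, h1]
    · simp only [hb, if_false, decide_false, Bool.false_eq_true]
      by_cases h0 : r = A.rank + 2
      · subst h0; simp
      · simp [h0, Ne.symm h0]

/-- The condition `p` is left arbitrary because it serves twice: to fix a corner block, and to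
impose the edge conditions of a graph. -/
theorem card_symm_option [Finite K] (p : Matrix ι ι K → Prop) (r : ℕ) :
    (Nat.card {M : Matrix (Option ι) (Option ι) K //
        M.IsSymm ∧ M.rank = r ∧ p (M.submatrix some some)} : ℚ) =
      ∑ t ∈ Finset.range (Fintype.card ι + 1),
        (Nat.card {A : Matrix ι ι K // A.IsSymm ∧ A.rank = t ∧ p A} : ℚ) *
          aeval (Nat.card K : ℚ) (borderPoly (Fintype.card ι) t r) := by
  have : Finite (Matrix ι ι K) := inferInstanceAs (Finite (ι → ι → K))
  have : Finite (Matrix (Option ι) (Option ι) K) :=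
    inferInstanceAs (Finite (Option ι → Option ι → K))
  rw [card_eq_sum_card_fiber (β := {A : Matrix ι ι K // A.IsSymm ∧ p A})
    (fun M => ⟨M.1.submatrix some some, M.2.1.submatrix some, M.2.2.2⟩) (fun A => A.1.rank)
    (Finset.range (Fintype.card ι + 1))
    (fun A => Finset.mem_range_succ_iff.2 A.1.rank_le_card_width)
    (fun t => aeval (Nat.card K : ℚ) (borderPoly (Fintype.card ι) t r))]
  · refine Finset.sum_congr rfl fun t _ => ?_
    congr 2
    refine Nat.card_congr ((Equiv.subtypeSubtypeEquivSubtypeInter _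
      (fun A : Matrix ι ι K => A.rank = t)).trans (Equiv.subtypeEquivRight fun A => ?_))
    tauto
  · rintro ⟨A, hA, hp⟩
    rw [← card_rank_border hA r]
    congr 1
    refine Nat.card_congr
      { toFun := fun M => ⟨(fun i => M.1.1 (some i) none, M.1.1 none none), ?_⟩
        invFun := fun x => ⟨⟨border A x.1.1 x.1.2, isSymm_border hA _ _, x.2, hp⟩, rfl⟩
        left_inv := ?_
        right_inv := fun x => rfl }
    · obtain ⟨⟨M, h1, h2, h3⟩, h4⟩ := M
      rw [Subtype.mk.injEq] at h4
      subst h4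
      exact (congrArg Matrix.rank (eq_border h1).symm).trans h2
    · rintro ⟨⟨M, h1, h2, h3⟩, h4⟩
      rw [Subtype.mk.injEq] at h4
      subst h4
      exact Subtype.ext (Subtype.ext (eq_border h1).symm)

end Border

/-! ### Symmetric extensions of prescribed rank -/

theorem card_symm_reindex {K m n : Type*} [Field K] [Fintype m] [Fintype n] (e : m ≃ n)
    (p : Matrix m m K → Prop) (r : ℕ) :
    Nat.card {M : Matrix m m K // M.IsSymm ∧ M.rank = r ∧ p M} =
      Nat.card {M : Matrix n n K // M.IsSymm ∧ M.rank = r ∧ p (M.submatrix e e)} := by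
  refine Nat.card_congr ((Matrix.reindex e e).subtypeEquiv fun M => ?_)
  rw [Matrix.rank_reindex]
  have h : ((Matrix.reindex e e) M).submatrix e e = M := by ext; simp
  rw [h]
  refine and_congr_left fun _ => ⟨fun h => h.submatrix _, fun h' => ?_⟩
  rw [← h]
  exact h'.submatrix _

/-- Moves the additional element out of the right summand. -/
def sumFinSuccEquiv (ι : Type*) (j : ℕ) : ι ⊕ Fin (j + 1) ≃ Option (ι ⊕ Fin j) :=
  (Equiv.sumCongr (Equiv.refl ι) finSuccEquivLast).trans
    { toFun := Sum.elim (fun i => some (Sum.inl i)) (Option.map Sum.inr)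
      invFun := fun o => o.elim (Sum.inr none) (Sum.map id some)
      left_inv := by rintro (i | _ | i) <;> rfl
      right_inv := by rintro (_ | _ | i) <;> rfl }

/-- The number of symmetric matrices of size `k + j` and rank `r` that extend a given symmetric
`k × k` matrix of rank `t`, as a polynomial in the number of elements of the field. -/
noncomputable def extPoly (k t : ℕ) : ℕ → ℕ → ℤ[X]
  | 0, r => if t = r then 1 else 0
  | j + 1, r => ∑ t' ∈ Finset.range (k + j + 1), extPoly k t j t' * borderPoly (k + j) t' r

theorem card_symm_extension {K ι : Type*} [Field K] [Finite K] [Fintype ι] {A : Matrix ι ι K}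
    (hA : A.IsSymm) (j r : ℕ) :
    (Nat.card {M : Matrix (ι ⊕ Fin j) (ι ⊕ Fin j) K //
        M.IsSymm ∧ M.rank = r ∧ M.toBlocks₁₁ = A} : ℚ) =
      aeval (Nat.card K : ℚ) (extPoly (Fintype.card ι) A.rank j r) := by
  induction j generalizing r with
  | zero =>
    rw [card_symm_reindex (Equiv.sumEmpty ι (Fin 0)), extPoly]
    have h : ∀ M : Matrix ι ι K,
        (M.submatrix (Equiv.sumEmpty ι (Fin 0)) (Equiv.sumEmpty ι (Fin 0))).toBlocks₁₁ = M :=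
      fun M => rfl
    simp_rw [h]
    split_ifs with hr
    · have : Unique {M : Matrix ι ι K // M.IsSymm ∧ M.rank = r ∧ M = A} :=
        { default := ⟨A, hA, hr, rfl⟩
          uniq := fun M => Subtype.ext M.2.2.2 }
      simp
    · have : IsEmpty {M : Matrix ι ι K // M.IsSymm ∧ M.rank = r ∧ M = A} :=
        ⟨fun M => hr (M.2.2.2 ▸ M.2.2.1)⟩
      simp
  | succ j ih =>
    rw [card_symm_reindex (sumFinSuccEquiv ι j)]
    have h := card_symm_option (K := K) (ι := ι ⊕ Fin j) (fun M => M.toBlocks₁₁ = A) r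
    simp_rw [ih] at h
    refine Eq.trans ?_ (h.trans ?_)
    · rfl
    · simp [extPoly]

/-! ### Families of vectors with prescribed span dimensions -/

/-- The number of ways to append a vector in dimension `n`, changing the dimensions of two nested
subspaces from `d` to `d'`, as a polynomial in the number of elements of the field. -/
noncomputable def appendPoly (n : ℕ) (d d' : ℕ × ℕ) : ℤ[X] :=
  X ^ d.1 * (if d' = d then 1 else 0) +
    (X ^ d.2 - X ^ d.1) * (if d' = (d.1 + 1, d.2) then 1 else 0) +
    (X ^ n - X ^ d.2) * (if d' = (d.1 + 1, d.2 + 1) then 1 else 0)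

/-- The number of families `x` of `s` vectors in dimension `n` such that the span of `x` and its sum
with a given subspace of dimension `t` have dimensions `d`, as a polynomial in the number of
elements of the field. -/
noncomputable def familyPoly (n t : ℕ) : ℕ → ℕ × ℕ → ℤ[X]
  | 0, d => if (0, t) = d then 1 else 0
  | s + 1, d => ∑ d' ∈ Finset.range (n + 1) ×ˢ Finset.range (n + 1),
      familyPoly n t s d' * appendPoly n d' d

section Families

variable {K E : Type*} [Field K] [Finite K] [AddCommGroup E] [Module K E] [FiniteDimensional K E]

/-- The three terms of `appendPoly` are the cases v ∈ U, v ∈ W \ U and v ∉ W. -/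
theorem card_append {U W : Submodule K E} (h : U ≤ W) (d : ℕ × ℕ) :
    (Nat.card {v : E // (finrank K ↥(U ⊔ Submodule.span K {v}),
        finrank K ↥(W ⊔ Submodule.span K {v})) = d} : ℚ) =
      aeval (Nat.card K : ℚ) (appendPoly (finrank K E) (finrank K U, finrank K W) d) := by
  classical
  have : Finite E := Module.finite_of_finite K
  have hU : ∀ (U : Submodule K E) {v}, v ∈ U →
      finrank K ↥(U ⊔ Submodule.span K {v}) = finrank K U := fun U v hv => by
    rw [sup_eq_left.2 ((Submodule.span_singleton_le_iff_mem _ _).2 hv)]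
  let ρ : E → Fin 3 := fun v => if v ∈ U then 0 else if v ∈ W then 1 else 2
  rw [card_eq_sum_card_fiber (fun v => v.1) ρ Finset.univ (fun _ => Finset.mem_univ _)
    ![if d = (finrank K U, finrank K W) then 1 else 0,
      if d = (finrank K U + 1, finrank K W) then 1 else 0,
      if d = (finrank K U + 1, finrank K W + 1) then 1 else 0]]
  · have h0 : (Nat.card {v // ρ v = 0} : ℚ) = (Nat.card K : ℚ) ^ finrank K U := by
      have : ∀ v, ρ v = 0 ↔ v ∈ U := by intro v; simp only [ρ]; split_ifs <;> simp_all
      simp_rw [this]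
      exact_mod_cast natCard_submodule U
    have h1 : (Nat.card {v // ρ v = 1} : ℚ) =
        (Nat.card K : ℚ) ^ finrank K W - (Nat.card K : ℚ) ^ finrank K U := by
      have : ∀ v, ρ v = 1 ↔ v ∈ W ∧ v ∉ U := by
        intro v; simp only [ρ]; split_ifs <;> simp_all
      simp_rw [this]
      exact natCard_diff_submodule h
    have h2 : (Nat.card {v // ρ v = 2} : ℚ) =
        (Nat.card K : ℚ) ^ finrank K E - (Nat.card K : ℚ) ^ finrank K W := by
      have : ∀ v, ρ v = 2 ↔ v ∈ (⊤ : Submodule K E) ∧ v ∉ W := by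
        intro v
        have := @h v
        simp only [ρ]; split_ifs <;> simp_all
      simp_rw [this]
      rw [natCard_diff_submodule le_top, finrank_top]
    rw [Fin.sum_univ_three, h0, h1, h2, appendPoly]
    simp [apply_ite (aeval (Nat.card K : ℚ))]
  · intro v
    have hc : ∀ (p : E → Prop), (Nat.card {a : {v // p v} // a.1 = v} : ℚ) =
        if p v then 1 else 0 := by
      intro p
      split_ifs with hp
      · have : Unique {a : {v // p v} // a.1 = v} :=
          { default := ⟨⟨v, hp⟩, rfl⟩
            uniq := fun a => Subtype.ext (Subtype.ext a.2) }
        simp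
      · have : IsEmpty {a : {v // p v} // a.1 = v} := ⟨fun a => hp (a.2 ▸ a.1.2)⟩
        simp
    rw [hc]
    by_cases h0 : v ∈ U
    · simp [ρ, h0, hU U h0, hU W (h h0), eq_comm]
    · by_cases h1 : v ∈ W
      · simp [ρ, h0, h1, hU W h1, Submodule.finrank_sup_span_singleton h0, eq_comm]
      · simp [ρ, h0, h1, Submodule.finrank_sup_span_singleton h0,
          Submodule.finrank_sup_span_singleton h1, eq_comm]

/-- Both dimensions are tracked because their equality says that the span contains T, the condition
needed on the columns of F. -/
theorem card_families (T : Submodule K E) (s : ℕ) (d : ℕ × ℕ) :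
    (Nat.card {x : Fin s → E // (finrank K ↥(Submodule.span K (Set.range x)),
        finrank K ↥(Submodule.span K (Set.range x) ⊔ T)) = d} : ℚ) =
      aeval (Nat.card K : ℚ) (familyPoly (finrank K E) (finrank K T) s d) := by
  have : Finite E := Module.finite_of_finite K
  induction s generalizing d with
  | zero =>
    have h0 : ∀ x : Fin 0 → E, (finrank K ↥(Submodule.span K (Set.range x)),
        finrank K ↥(Submodule.span K (Set.range x) ⊔ T)) = (0, finrank K T) := by
      intro x
      rw [Set.range_eq_empty, Submodule.span_empty, finrank_bot, bot_sup_eq]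
    simp_rw [h0, familyPoly]
    split_ifs with h <;> simp [h]
  | succ s ih =>
    rw [card_eq_sum_card_fiber (β := Fin s → E) (fun x => Fin.tail x.1)
      (fun x => (finrank K ↥(Submodule.span K (Set.range x)),
        finrank K ↥(Submodule.span K (Set.range x) ⊔ T)))
      (Finset.range (finrank K E + 1) ×ˢ Finset.range (finrank K E + 1))
      (fun x => by simp [Submodule.finrank_le])
      (fun d' => aeval (Nat.card K : ℚ) (appendPoly (finrank K E) d' d))]
    · simp_rw [ih]
      simp [familyPoly]
    · intro y
      rw [← card_append le_sup_left]
      congr 1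
      have hs : ∀ v : E, Submodule.span K (Set.range (Fin.cons v y : Fin (s + 1) → E)) =
          Submodule.span K (Set.range y) ⊔ Submodule.span K {v} := by
        intro v
        rw [Fin.range_cons, Submodule.span_insert, sup_comm]
      refine Nat.card_congr
        { toFun := fun x => ⟨x.1.1 0, ?_⟩
          invFun := fun v => ⟨⟨Fin.cons v.1 y, ?_⟩, Fin.tail_cons _ _⟩
          left_inv := ?_
          right_inv := fun v => rfl }
      · obtain ⟨⟨x, hx⟩, rfl⟩ := x
        rw [sup_right_comm, ← hs, Fin.cons_self_tail]
        exact hx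
      · rw [hs, sup_right_comm]
        exact v.2
      · rintro ⟨⟨x, hx⟩, rfl⟩
        exact Subtype.ext (Subtype.ext (Fin.cons_self_tail x))

end Families

/-- Each appended vector raises the first dimension by at most one and never lowers the second,
which starts at t. -/
theorem familyPoly_eq_zero (n t s : ℕ) (d : ℕ × ℕ) (hd : s < d.1 ∨ d.2 < t) :
    familyPoly n t s d = 0 := by
  induction s generalizing d with
  | zero =>
    rw [familyPoly, if_neg]
    rintro rfl
    simp at hd
  | succ s ih =>
    rw [familyPoly]
    refine Finset.sum_eq_zero fun d' _ => ?_
    by_cases h' : s < d'.1 ∨ d'.2 < t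
    · rw [ih d' h', zero_mul]
    · have h1 : d ≠ d' := by rintro rfl; omega
      have h2 : d ≠ (d'.1 + 1, d'.2) := by rintro rfl; simp at hd; omega
      have h3 : d ≠ (d'.1 + 1, d'.2 + 1) := by rintro rfl; simp at hd; omega
      simp [appendPoly, h1, h2, h3]

/-- Reaching (s, t) forces every vector to lie in T and outside the span of the others already
chosen, so the i-th choice contributes q^t - q^i. -/
theorem familyPoly_independent (n t s : ℕ) (hs : s ≤ t) (ht : t ≤ n) :
    familyPoly n t s (s, t) = ∏ i ∈ Finset.range s, (X ^ t - X ^ i) := by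
  induction s with
  | zero => simp [familyPoly]
  | succ s ih =>
    rw [familyPoly, Finset.sum_eq_single (s, t), ih (by omega), Finset.prod_range_succ]
    · simp [appendPoly]
    · intro d' _ hd'
      by_cases h' : s < d'.1 ∨ d'.2 < t
      · rw [familyPoly_eq_zero n t s d' h', zero_mul]
      · have h1 : (s + 1, t) ≠ d' := by rintro rfl; simp at h'
        have h2 : (s + 1, t) ≠ (d'.1 + 1, d'.2) := by
          intro h; apply hd'; ext <;> simp_all
        have h3 : (s + 1, t) ≠ (d'.1 + 1, d'.2 + 1) := by
          intro h; simp at h; omega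
        simp [appendPoly, h1, h2, h3]
    · intro h
      simp at h
      omega

/-! ### Symmetric matrices with a prescribed congruence transform -/

theorem isSymm_congruence {K m n : Type*} [Field K] [Fintype n] {A : Matrix n n K} (hA : A.IsSymm)
    (B : Matrix m n K) : (B * A * Bᵀ).IsSymm := by
  rw [Matrix.IsSymm, transpose_mul, transpose_mul, hA.eq, transpose_transpose, Matrix.mul_assoc]

section Congruence

variable {K V : Type*} [Field K] [Fintype V]

/-- Use a basis of K^s adapted to a complement of ker F and to ker F itself. F kills the second part
and is injective on the first, whence the left inverse `L`. -/
theorem exists_column_reduction {s k : ℕ} (F : Matrix V (Fin s) K) (hF : F.rank = k) :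
    ∃ (g : Matrix (Fin s) (Fin k ⊕ Fin (s - k)) K) (g' : Matrix (Fin k ⊕ Fin (s - k)) (Fin s) K)
      (F₁ : Matrix V (Fin k) K) (L : Matrix (Fin k) V K),
      g * g' = 1 ∧ g' * g = 1 ∧ F * g = fromCols F₁ 0 ∧ L * F₁ = 1 := by
  classical
  obtain ⟨C, hC⟩ := Submodule.exists_isCompl (LinearMap.ker F.mulVecLin)
  have h1 : finrank K (LinearMap.range F.mulVecLin) = k := hF
  have h2 := F.mulVecLin.finrank_range_add_finrank_ker
  have h3 := Submodule.finrank_add_eq_of_isCompl hC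
  rw [finrank_fin_fun] at h2 h3
  let bC : Basis (Fin k) K C := finBasisOfFinrankEq K C (by omega)
  let bU : Basis (Fin (s - k)) K (LinearMap.ker F.mulVecLin) :=
    finBasisOfFinrankEq K _ (by omega)
  let b : Basis (Fin k ⊕ Fin (s - k)) K (Fin s → K) :=
    (bC.prod bU).map (Submodule.prodEquivOfIsCompl C _ hC.symm)
  have hbl : ∀ i, b (Sum.inl i) = bC i := fun i => by simp [b]
  have hbr : ∀ i, b (Sum.inr i) = bU i := fun i => by simp [b]
  let g := (Pi.basisFun K (Fin s)).toMatrix b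
  let F₁ : Matrix V (Fin k) K := of fun v i => (F *ᵥ (bC i : Fin s → K)) v
  have hF₁ : ∀ x, F₁ *ᵥ x = F *ᵥ (bC.equivFun.symm x : C) := by
    intro x
    rw [Basis.equivFun_symm_apply, AddSubmonoidClass.coe_finsetSum, mulVec_sum]
    ext v
    simp only [mulVec, dotProduct, F₁, of_apply, Finset.sum_apply, Submodule.coe_smul,
      Pi.smul_apply, smul_eq_mul, Finset.sum_mul]
    exact Finset.sum_congr rfl fun i _ => Finset.sum_congr rfl fun j _ => by ring
  have hinj : LinearMap.ker F₁.mulVecLin = ⊥ := by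
    rw [LinearMap.ker_eq_bot']
    intro x hx
    rw [mulVecLin_apply, hF₁] at hx
    have hd := Submodule.disjoint_def.1 hC.disjoint _ (LinearMap.mem_ker.2 hx) (Subtype.mem _)
    exact (LinearEquiv.map_eq_zero_iff _).1 (Subtype.ext hd)
  obtain ⟨l, hl⟩ := F₁.mulVecLin.exists_leftInverse_of_injective hinj
  refine ⟨g, b.toMatrix (Pi.basisFun K (Fin s)), F₁, LinearMap.toMatrix' l,
    Basis.toMatrix_mul_toMatrix_flip _ _, Basis.toMatrix_mul_toMatrix_flip _ _, ?_, ?_⟩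
  · ext v (i | i)
    · have : (F * g) v (Sum.inl i) = (F *ᵥ b (Sum.inl i)) v := rfl
      rw [this, hbl]
      rfl
    · have : (F * g) v (Sum.inr i) = (F *ᵥ b (Sum.inr i)) v := rfl
      rw [this, hbr, fromCols_apply_inr]
      exact congrFun (LinearMap.mem_ker.1 (bU i).2) v
  · rw [← LinearMap.toMatrix'_toLin' F₁, Matrix.toLin'_apply', ← LinearMap.toMatrix'_comp, hl,
      LinearMap.toMatrix'_id]

/-- In coordinates where F = (F₁ 0), the equation constrains only the upper left k × k block B of Q,
as F₁ B F₁ᵀ = P. Its unique solution is L P Lᵀ, of the same rank as P, so what remains is to count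
symmetric extensions of that block. -/
theorem card_symm_congruence [Finite K] {s k : ℕ} (F : Matrix V (Fin s) K) (hF : F.rank = k)
    {P : Matrix V V K} (hP : P.IsSymm)
    (h : Submodule.span K (Set.range P.col) ≤ Submodule.span K (Set.range F.col)) (r : ℕ) :
    (Nat.card {Q : Matrix (Fin s) (Fin s) K // Q.IsSymm ∧ Q.rank = r ∧ F * Q * Fᵀ = P} : ℚ) =
      aeval (Nat.card K : ℚ) (extPoly k P.rank (s - k) r) := by
  classical
  obtain ⟨g, g', F₁, L, hg, hg', hFg, hL⟩ := exists_column_reduction F hF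
  have hcol : ∀ j, ∃ y, F *ᵥ y = P.col j := fun j =>
    (mem_span_col_iff F _).1 (h (Submodule.subset_span ⟨j, rfl⟩))
  choose y hy using hcol
  have hFF : F = (fromCols F₁ 0 : Matrix V (Fin k ⊕ Fin (s - k)) K) * g' := by rw [← hFg, Matrix.mul_assoc, hg, Matrix.mul_one]
  -- The columns of P lie in the column space of F₁, on which `F₁ * L` acts as the identity.
  obtain ⟨Z, hZ⟩ : ∃ Z : Matrix (Fin k) V K, P = F₁ * Z := by
    refine ⟨(g' * of fun i j => y j i).toRows₁, ?_⟩
    have h1 : P = F * of fun i j => y j i := by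
      ext i j
      exact (congrFun (hy j) i).symm
    rw [h1]
    conv_lhs => rw [hFF, Matrix.mul_assoc, ← fromRows_toRows (g' * _), fromCols_mul_fromRows]
    simp
  have hP1 : F₁ * L * P = P := by
    rw [hZ, Matrix.mul_assoc, ← Matrix.mul_assoc L, hL, Matrix.one_mul]
  have hP2 : P * (F₁ * L)ᵀ = P := by
    have := congrArg transpose hP1
    rwa [transpose_mul, hP.eq] at this
  have hPP : F₁ * (L * P * Lᵀ) * F₁ᵀ = P := by
    calc _ = (F₁ * L * P) * (F₁ * L)ᵀ := by simp only [transpose_mul, Matrix.mul_assoc]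
      _ = P := by rw [hP1, hP2]
  have hr : (L * P * Lᵀ).rank = P.rank := by
    apply le_antisymm
    · exact (rank_mul_le_left _ _).trans (rank_mul_le_right _ _)
    · conv_lhs => rw [← hPP]
      exact (rank_mul_le_left _ _).trans (rank_mul_le_right _ _)
  have hs : (L * P * Lᵀ).IsSymm := isSymm_congruence hP L
  have hblock : ∀ Q : Matrix (Fin k ⊕ Fin (s - k)) (Fin k ⊕ Fin (s - k)) K,
      F * (g * Q * gᵀ) * Fᵀ = F₁ * Q.toBlocks₁₁ * F₁ᵀ := by
    intro Q
    calc _ = (F * g) * Q * (F * g)ᵀ := by simp only [transpose_mul, Matrix.mul_assoc]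
      _ = _ := by
        rw [hFg]
        conv_lhs => rw [← fromBlocks_toBlocks Q, transpose_fromCols,
          fromCols_mul_fromBlocks, fromCols_mul_fromRows]
        simp
  have hiff : ∀ Q : Matrix (Fin k ⊕ Fin (s - k)) (Fin k ⊕ Fin (s - k)) K,
      F * (g * Q * gᵀ) * Fᵀ = P ↔ Q.toBlocks₁₁ = L * P * Lᵀ := by
    intro Q
    rw [hblock]
    constructor
    · intro hQ
      have hLt : F₁ᵀ * Lᵀ = 1 := by rw [← transpose_mul, hL, transpose_one]
      calc Q.toBlocks₁₁ = (L * F₁) * Q.toBlocks₁₁ * (F₁ᵀ * Lᵀ) := by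
            rw [hL, hLt, Matrix.one_mul, Matrix.mul_one]
        _ = L * (F₁ * Q.toBlocks₁₁ * F₁ᵀ) * Lᵀ := by simp only [Matrix.mul_assoc]
        _ = _ := by rw [hQ]
    · rintro hQ
      rw [hQ, hPP]
  have hgt : gᵀ * g'ᵀ = 1 := by rw [← transpose_mul, hg', transpose_one]
  have hgt' : g'ᵀ * gᵀ = 1 := by rw [← transpose_mul, hg, transpose_one]
  have inv1 : ∀ Q : Matrix (Fin k ⊕ Fin (s - k)) (Fin k ⊕ Fin (s - k)) K,
      g' * (g * Q * gᵀ) * g'ᵀ = Q := fun Q => by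
    calc _ = (g' * g) * Q * (gᵀ * g'ᵀ) := by simp only [Matrix.mul_assoc]
      _ = Q := by rw [hg', hgt, Matrix.one_mul, Matrix.mul_one]
  have inv2 : ∀ Q : Matrix (Fin s) (Fin s) K, g * (g' * Q * g'ᵀ) * gᵀ = Q := fun Q => by
    calc _ = (g * g') * Q * (g'ᵀ * gᵀ) := by simp only [Matrix.mul_assoc]
      _ = Q := by rw [hg, hgt', Matrix.one_mul, Matrix.mul_one]
  have hcard := card_symm_extension hs (s - k) r
  rw [hr, Fintype.card_fin] at hcard
  rw [← hcard]
  congr 1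
  refine (Nat.card_congr (Equiv.subtypeEquiv
    { toFun := fun Q => g * Q * gᵀ
      invFun := fun Q => g' * Q * g'ᵀ
      left_inv := inv1
      right_inv := inv2 } fun Q => ?_)).symm
  change _ ↔ (g * Q * gᵀ).IsSymm ∧ (g * Q * gᵀ).rank = r ∧ F * (g * Q * gᵀ) * Fᵀ = P
  have hrank : (g * Q * gᵀ).rank = Q.rank := by
    apply le_antisymm
    · exact (rank_mul_le_left _ _).trans (rank_mul_le_right _ _)
    · conv_lhs => rw [← inv1 Q]
      exact (rank_mul_le_left _ _).trans (rank_mul_le_right _ _)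
  have hsymm : (g * Q * gᵀ).IsSymm ↔ Q.IsSymm :=
    ⟨fun hQ => inv1 Q ▸ isSymm_congruence hQ g', fun hQ => isSymm_congruence hQ g⟩
  rw [hrank, hsymm, hiff]

theorem card_congruence_pairs [Finite K] {P : Matrix V V K} (hP : P.IsSymm) (s r k : ℕ) :
    (Nat.card {x : Matrix (Fin s) (Fin s) K × Matrix V (Fin s) K //
        x.1.IsSymm ∧ x.1.rank = r ∧ x.2.rank = k ∧ x.2 * x.1 * x.2ᵀ = P} : ℚ) =
      aeval (Nat.card K : ℚ)
        (familyPoly (Fintype.card V) P.rank s (k, k) * extPoly k P.rank (s - k) r) := by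
  classical
  have : Finite (Matrix (Fin s) (Fin s) K) := inferInstanceAs (Finite (Fin s → Fin s → K))
  have : Finite (Matrix V (Fin s) K) := inferInstanceAs (Finite (V → Fin s → K))
  set T := Submodule.span K (Set.range P.col) with hT
  have hTr : finrank K T = P.rank := (rank_eq_finrank_span_cols P).symm
  let ρ : (Fin s → V → K) → ℕ × ℕ := fun y => (finrank K ↥(Submodule.span K (Set.range y)),
    finrank K ↥(Submodule.span K (Set.range y) ⊔ T))
  have hfam := card_families T s (k, k)
  rw [hTr, finrank_fintype_fun_eq_card] at hfam
  rw [card_eq_sum_card_fiber (β := Fin s → V → K) (fun x => x.1.2.col) ρ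
    -- Here k may exceed the number of vertices, so (k, k) is inserted to make sure that the sum has
    -- this term.
    (insert (k, k) (Finset.range (Fintype.card V + 1) ×ˢ Finset.range (Fintype.card V + 1)))
    (fun y => by
      refine Finset.mem_insert_of_mem (Finset.mem_product.2 ⟨?_, ?_⟩) <;>
      · rw [Finset.mem_range_succ_iff, ← finrank_fintype_fun_eq_card K]
        exact Submodule.finrank_le _)
    (fun d => if d = (k, k) then aeval (Nat.card K : ℚ) (extPoly k P.rank (s - k) r) else 0)]
  · simp only [mul_ite, mul_zero, Finset.sum_ite_eq', Finset.mem_insert_self, if_true]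
    rw [hfam, map_mul]
  · intro y
    obtain ⟨F, rfl⟩ : ∃ F : Matrix V (Fin s) K, F.col = y := ⟨(of y)ᵀ, rfl⟩
    have hFr : F.rank = finrank K (Submodule.span K (Set.range F.col)) :=
      rank_eq_finrank_span_cols F
    split_ifs with h
    · have h1 : F.rank = k := hFr.trans (Prod.ext_iff.1 h).1
      have h2 : T ≤ Submodule.span K (Set.range F.col) := by
        have : finrank K (Submodule.span K (Set.range F.col)) =
            finrank K ↥(Submodule.span K (Set.range F.col) ⊔ T) :=
          (Prod.ext_iff.1 h).1.trans (Prod.ext_iff.1 h).2.symm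
        rw [Submodule.eq_of_le_of_finrank_eq le_sup_left this]
        exact le_sup_right
      rw [← card_symm_congruence F h1 hP h2]
      congr 1
      have hF : ∀ {F' : Matrix V (Fin s) K}, F'.col = F.col → F' = F := fun h =>
        transpose_injective h
      refine Nat.card_congr
        { toFun := fun x => ⟨x.1.1.1, x.1.2.1, x.1.2.2.1, ?_⟩
          invFun := fun Q => ⟨⟨(Q.1, F), Q.2.1, Q.2.2.1, h1, Q.2.2.2⟩, rfl⟩
          left_inv := ?_
          right_inv := fun Q => rfl }
      · have := x.1.2.2.2.2
        rwa [hF x.2] at this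
      · rintro ⟨⟨⟨Q, F'⟩, hx⟩, h'⟩
        obtain rfl := hF h'
        rfl
    · have : IsEmpty {a : {x : Matrix (Fin s) (Fin s) K × Matrix V (Fin s) K //
          x.1.IsSymm ∧ x.1.rank = r ∧ x.2.rank = k ∧ x.2 * x.1 * x.2ᵀ = P} //
            a.1.2.col = F.col} := by
        refine ⟨?_⟩
        rintro ⟨⟨⟨Q, F'⟩, h1, h2, h3, h4⟩, h'⟩
        obtain rfl : F' = F := transpose_injective h'
        apply h
        -- P = F (Q Fᵀ) puts the columns of P in the column space of F, so no other F has a nonempty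
        -- fibre.
        have hle : T ≤ Submodule.span K (Set.range F'.col) := by
          rw [hT, Submodule.span_le]
          rintro _ ⟨j, rfl⟩
          refine (mem_span_col_iff F' _).2 ⟨(Q * F'ᵀ).col j, ?_⟩
          change F' * Q * F'ᵀ = P at h4
          rw [← h4, Matrix.mul_assoc]
          rfl
        have h3' : F'.rank = k := h3
        simp only [ρ]
        rw [sup_eq_left.2 hle, ← hFr, h3']
      simp

end Congruence

/-! ### Points over a finite field -/

/-- The left radical of the form is the kernel of Aᵀ; rank-nullity then compares the ranks. -/
theorem finrank_range_toBilin' {K n : Type*} [Field K] [Fintype n] [DecidableEq n]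
    (A : Matrix n n K) : finrank K (LinearMap.range (Matrix.toBilin' A)) = A.rank := by
  have h : LinearMap.ker (Matrix.toBilin' A) = LinearMap.ker Aᵀ.mulVecLin := by
    ext x
    rw [LinearMap.mem_ker, LinearMap.mem_ker, mulVecLin_apply, mulVec_transpose,
      LinearMap.ext_iff]
    simp only [Matrix.toBilin'_apply', LinearMap.zero_apply, dotProduct_mulVec]
    constructor
    · exact fun h => dotProduct_eq_zero _ h
    · intro h y
      rw [h, zero_dotProduct]
  have h1 := (Matrix.toBilin' A).finrank_range_add_finrank_ker
  have h2 := Aᵀ.mulVecLin.finrank_range_add_finrank_ker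
  rw [h] at h1
  rw [← rank_transpose A, Matrix.rank]
  omega

/-- Symmetric matrices of rank `t` whose entries vanish on the edges of `G`. -/
def RankPoints (G : FinSimpleGraph.{u}) (t : ℕ) (K : Type) [Field K] : Set (Matrix G.V G.V K) :=
  {M | M.IsSymm ∧ M.rank = t ∧ ∀ v w, G.graph.Adj v w → M v w = 0}

theorem natCard_APoints (G : FinSimpleGraph.{u}) (s r k : ℕ) (K : Type) [Field K] [Finite K] :
    (Nat.card (APoints G s r k K) : ℚ) = ∑ t ∈ Finset.range (Fintype.card G.V + 1),
      (Nat.card (RankPoints G t K) : ℚ) * aeval (Nat.card K : ℚ)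
        (familyPoly (Fintype.card G.V) t s (k, k) * extPoly k t (s - k) r) := by
  classical
  have : Finite (Matrix G.V G.V K) := inferInstanceAs (Finite (G.V → G.V → K))
  have : Finite (Matrix (Fin s) (Fin s) K) := inferInstanceAs (Finite (Fin s → Fin s → K))
  have : Finite (Matrix G.V (Fin s) K) := inferInstanceAs (Finite (G.V → Fin s → K))
  have e : {x : Matrix (Fin s) (Fin s) K × Matrix G.V (Fin s) K // x.1.IsSymm ∧ x.1.rank = r ∧
      x.2.rank = k ∧ ∀ v w, G.graph.Adj v w → (x.2 * x.1 * x.2ᵀ) v w = 0} ≃ APoints G s r k K := by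
    refine Equiv.subtypeEquiv (Equiv.prodCongr Matrix.toBilin'.toEquiv Matrix.of.symm) ?_
    rintro ⟨Q, F⟩
    change _ ↔ (Matrix.toBilin' Q).IsSymm ∧ finrank K (LinearMap.range (Matrix.toBilin' Q)) = r ∧
      finrank K (Submodule.span K (Set.range F.row)) = k ∧
      ∀ v w, G.graph.Adj v w → Matrix.toBilin' Q (F v) (F w) = 0
    rw [finrank_range_toBilin', ← rank_eq_finrank_span_row]
    have h1 : (Matrix.toBilin' Q).IsSymm ↔ Q.IsSymm := by
      rw [LinearMap.BilinForm.isSymm_def]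
      constructor
      · intro h
        ext i j
        have := h (Pi.single j 1) (Pi.single i 1)
        rwa [Matrix.toBilin'_single, Matrix.toBilin'_single] at this
      · intro h x y
        rw [Matrix.toBilin'_apply', Matrix.toBilin'_apply', dotProduct_mulVec, ← mulVec_transpose,
          h.eq, dotProduct_comm]
    have h2 : ∀ v w, (F * Q * Fᵀ) v w = Matrix.toBilin' Q (F v) (F w) := by
      intro v w
      rw [Matrix.toBilin'_apply', dotProduct_mulVec]
      rfl
    simp only [h1, h2]
  rw [← Nat.card_congr e, card_eq_sum_card_fiber
    (β := {P : Matrix G.V G.V K // P.IsSymm ∧ ∀ v w, G.graph.Adj v w → P v w = 0})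
    (fun x => ⟨x.1.2 * x.1.1 * x.1.2ᵀ, isSymm_congruence x.2.1 x.1.2, x.2.2.2.2⟩)
    (fun P => P.1.rank) (Finset.range (Fintype.card G.V + 1))
    (fun P => Finset.mem_range_succ_iff.2 P.1.rank_le_card_width)
    (fun t => aeval (Nat.card K : ℚ)
      (familyPoly (Fintype.card G.V) t s (k, k) * extPoly k t (s - k) r))]
  · refine Finset.sum_congr rfl fun t _ => ?_
    congr 2
    refine Nat.card_congr ((Equiv.subtypeSubtypeEquivSubtypeInter _
      (fun A : Matrix G.V G.V K => A.rank = t)).trans (Equiv.subtypeEquivRight fun A => ?_))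
    simp only [RankPoints, Set.mem_ofPred_eq]
    tauto
  · rintro ⟨P, hP, hG⟩
    rw [← card_congruence_pairs hP]
    congr 1
    refine Nat.card_congr
      { toFun := fun x => ⟨x.1.1, x.1.2.1, x.1.2.2.1, x.1.2.2.2.1, congrArg Subtype.val x.2⟩
        invFun := fun x => ⟨⟨x.1, x.2.1, x.2.2.1, x.2.2.2.1, ?_⟩, Subtype.ext x.2.2.2.2⟩
        left_inv := fun x => rfl
        right_inv := fun x => rfl }
    rw [x.2.2.2.2]
    exact hG

theorem natCard_RankPoints_D (G : FinSimpleGraph.{u}) (r : ℕ) (K : Type) [Field K] [Finite K] :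
    (Nat.card (RankPoints (D G) r K) : ℚ) = ∑ t ∈ Finset.range (Fintype.card G.V + 1),
      (Nat.card (RankPoints G t K) : ℚ) *
        aeval (Nat.card K : ℚ) (borderPoly (Fintype.card G.V) t r) := by
  refine Eq.trans ?_ (card_symm_option
    (fun A : Matrix G.V G.V K => ∀ v w, G.graph.Adj v w → A v w = 0) r)
  congr 1
  refine Nat.card_congr (Equiv.subtypeEquivRight fun M => ?_)
  refine and_congr Iff.rfl (and_congr ?_ ?_)
  · exact Eq.congr (by congr!) rfl
  · change (∀ v w, (G.graph.map Function.Embedding.some).Adj v w → M v w = 0) ↔ _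
    constructor
    · intro h v w hvw
      exact h _ _ ((SimpleGraph.map_adj _ _ _ _).2 ⟨v, w, hvw, rfl, rfl⟩)
    · intro h v w hvw
      obtain ⟨v', w', hvw', rfl, rfl⟩ := (SimpleGraph.map_adj _ _ _ _).1 hvw
      exact h v' w' hvw'

/-! ### Modules of counting functions -/

theorem evalHom_apply (p : ℤ[X]) (q : PrimePower) : evalHom p q = aeval (q.1 : ℚ) p := rfl

theorem algebraMap_algebraMap_eq (p : ℤ[X]) :
    algebraMap R CountFun (algebraMap ℤ[X] R p) = evalHom p :=
  IsLocalization.lift_eq isUnit_evalHom p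

theorem evalHom_mul_mem {N : Submodule R CountFun} {F : CountFun} (hF : F ∈ N) (p : ℤ[X]) :
    evalHom p * F ∈ N := by
  rw [← algebraMap_algebraMap_eq, ← Algebra.smul_def]
  exact N.smul_mem _ hF

theorem mem_of_evalHom_mul_mem {N : Submodule R CountFun} {F : CountFun} {p : ℤ[X]} (hp : p ∈ S)
    (hF : evalHom p * F ∈ N) : F ∈ N := by
  obtain ⟨v, hv⟩ := (IsLocalization.map_units R ⟨p, hp⟩ : IsUnit (algebraMap ℤ[X] R p))
  have h := N.smul_mem (↑v⁻¹ : R) hF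
  rwa [Algebra.smul_def, ← algebraMap_algebraMap_eq, ← hv, ← mul_assoc, ← map_mul, Units.inv_mul,
    map_one, one_mul] at h

theorem mem_S_of_dvd {f : ℤ[X]} {n : ℕ} (hn : 1 < n) (h : f ∣ X ^ n - X) : f ∈ S := by
  obtain ⟨g, hg⟩ := h
  refine Submonoid.mem_saturation_iff.mpr ⟨g, ?_⟩
  rw [← hg]
  exact Submonoid.subset_closure ⟨n, hn, rfl⟩

theorem X_mem_S : (X : ℤ[X]) ∈ S :=
  mem_S_of_dvd one_lt_two ⟨X - 1, by ring⟩

/-- Saturation supplies the factors: X divides X² - X, and X^(m+1) - 1 divides X^(m+2) - X. -/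
theorem X_pow_sub_X_pow_mem_S {t n : ℕ} (h : t < n) : (X ^ n - X ^ t : ℤ[X]) ∈ S := by
  obtain ⟨m, rfl⟩ := Nat.exists_eq_add_of_lt h
  have h1 : (X ^ (t + m + 1) - X ^ t : ℤ[X]) = X ^ t * (X ^ (m + 1) - 1) := by ring
  rw [h1]
  exact mul_mem (pow_mem X_mem_S t) (mem_S_of_dvd (n := m + 2) (by omega) ⟨X, by ring⟩)

/-- The function `q ↦ #RankPoints G t (𝔽_q)`. -/
noncomputable def countRank (G : FinSimpleGraph.{u}) (t : ℕ) : CountFun :=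
  fun q => (Nat.card (RankPoints G t (Fq q)) : ℚ)

theorem countZ_eq_countRank (G : FinSimpleGraph.{u}) :
    countZ G = countRank G (Fintype.card G.V) := rfl

theorem countA_eq_sum (G : FinSimpleGraph.{u}) (s r k : ℕ) :
    countA G s r k = ∑ t ∈ Finset.range (Fintype.card G.V + 1),
      evalHom (familyPoly (Fintype.card G.V) t s (k, k) * extPoly k t (s - k) r) *
        countRank G t := by
  ext q
  rw [countA, natCard_APoints, Finset.sum_apply]
  refine Finset.sum_congr rfl fun t _ => ?_
  rw [Pi.mul_apply, evalHom_apply, card_Fq, mul_comm]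
  rfl

theorem card_D (G : FinSimpleGraph.{u}) : Fintype.card (D G).V = Fintype.card G.V + 1 := by
  rw [← Nat.card_eq_fintype_card, ← Nat.card_eq_fintype_card]
  exact Finite.card_option

theorem countRank_D (G : FinSimpleGraph.{u}) (r : ℕ) :
    countRank (D G) r = ∑ t ∈ Finset.range (Fintype.card G.V + 1),
      evalHom (borderPoly (Fintype.card G.V) t r) * countRank G t := by
  ext q
  rw [countRank, natCard_RankPoints_D, Finset.sum_apply]
  refine Finset.sum_congr rfl fun t _ => ?_
  rw [Pi.mul_apply, evalHom_apply, card_Fq, mul_comm]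
  rfl

/-- The module generated by the functions `[Z_{D^k G}]`. -/
noncomputable def spanZ (G : FinSimpleGraph.{u}) : Submodule R CountFun :=
  Submodule.span R (Set.range fun k : ℕ => countZ (D^[k] G))

theorem spanZ_D_le (G : FinSimpleGraph.{u}) : spanZ (D G) ≤ spanZ G := by
  refine Submodule.span_mono ?_
  rintro _ ⟨k, rfl⟩
  exact ⟨k + 1, rfl⟩

theorem countRank_mem_spanZ (G : FinSimpleGraph.{u}) (t : ℕ) (ht : t ≤ Fintype.card G.V) :
    countRank G t ∈ spanZ G := by
  obtain ⟨d, hd⟩ := Nat.exists_eq_add_of_le ht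
  clear ht
  induction d using Nat.strong_induction_on generalizing G t with
  | _ d ih =>
    rcases d with _ | d
    · refine Submodule.subset_span ⟨0, ?_⟩
      simp only [Function.iterate_zero, id, countZ_eq_countRank, hd, add_zero]
    -- Passing to `D G` adds one to the size and two to the rank, so the corank drops by one.
    · have hD : countRank (D G) (t + 2) ∈ spanZ G :=
        spanZ_D_le G (ih d (by omega) (D G) (t + 2) (by rw [card_D]; omega))
      rw [countRank_D, ← Finset.add_sum_erase _ _ (Finset.mem_range.2
        (show t < Fintype.card G.V + 1 by omega))] at hD
      have hrest : ∑ t' ∈ (Finset.range (Fintype.card G.V + 1)).erase t,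
          evalHom (borderPoly (Fintype.card G.V) t' (t + 2)) * countRank G t' ∈ spanZ G := by
        refine Submodule.sum_mem _ fun t' ht' => ?_
        rw [Finset.mem_erase, Finset.mem_range] at ht'
        -- Ranks below t cannot reach t + 2 by one bordering; ranks above t have smaller corank in
        -- G.
        rcases lt_or_gt_of_ne ht'.1 with h | h
        · have h0 : borderPoly (Fintype.card G.V) t' (t + 2) = 0 := by
            rw [borderPoly, if_neg (by omega), if_neg (by omega), if_neg (by omega)]
            ring
          rw [h0, map_zero, zero_mul]
          exact zero_mem _
        · exact evalHom_mul_mem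
            (ih (Fintype.card G.V - t') (by omega) G t' (by omega)) _
      rw [Submodule.add_mem_iff_left _ hrest] at hD
      refine mem_of_evalHom_mul_mem ?_ hD
      have h1 : borderPoly (Fintype.card G.V) t (t + 2) = (X ^ Fintype.card G.V - X ^ t) * X := by
        simp [borderPoly]
      rw [h1]
      exact mul_mem (X_pow_sub_X_pow_mem_S (by omega)) X_mem_S

/-- With s = r = k = t nothing is left to extend (s - k = 0), so the single surviving term is rank
t. -/
theorem countRank_mem_M (G : FinSimpleGraph.{u}) (t : ℕ) (ht : t ≤ Fintype.card G.V) :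
    countRank G t ∈ M G := by
  have hA : countA G t t t ∈ M G := Submodule.subset_span ⟨t, t, t, rfl⟩
  rw [countA_eq_sum, Finset.sum_eq_single t] at hA
  · refine mem_of_evalHom_mul_mem ?_ hA
    rw [familyPoly_independent _ _ _ le_rfl ht, Nat.sub_self, extPoly, if_pos rfl, mul_one]
    exact prod_mem fun i hi => X_pow_sub_X_pow_mem_S (Finset.mem_range.1 hi)
  · intro t' _ ht'
    rw [Nat.sub_self, extPoly, if_neg ht', mul_zero, map_zero, zero_mul]
  · intro h
    exact absurd (Finset.mem_range.2 (Nat.lt_succ_of_le ht)) h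

theorem countZ_iterate_D_mem {N : Submodule R CountFun} (j : ℕ) (G : FinSimpleGraph.{u})
    (h : ∀ t ≤ Fintype.card G.V, countRank G t ∈ N) : countZ (D^[j] G) ∈ N := by
  induction j generalizing G with
  | zero => exact h _ le_rfl
  | succ j ih =>
    refine ih (D G) fun t _ => ?_
    rw [countRank_D]
    exact Submodule.sum_mem _ fun t' ht' =>
      evalHom_mul_mem (h t' (Nat.lt_succ_iff.1 (Finset.mem_range.1 ht'))) _

theorem M_eq_spanZ (G : FinSimpleGraph.{u}) : M G = spanZ G := by
  apply le_antisymm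
  · refine Submodule.span_le.2 ?_
    rintro _ ⟨s, r, k, rfl⟩
    rw [SetLike.mem_coe, countA_eq_sum]
    exact Submodule.sum_mem _ fun t ht =>
      evalHom_mul_mem (countRank_mem_spanZ G t (Nat.lt_succ_iff.1 (Finset.mem_range.1 ht))) _
  · refine Submodule.span_le.2 ?_
    rintro _ ⟨j, rfl⟩
    exact countZ_iterate_D_mem j G (countRank_mem_M G)

theorem spanZ_le_GraphsStar (G : FinSimpleGraph.{u}) : spanZ G ≤ GraphsStar.{u} := by
  refine Submodule.span_mono ?_
  rintro _ ⟨k, rfl⟩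
  exact ⟨_, rfl⟩

end GraphModules

theorem mainTheorem6 (G : GraphModules.FinSimpleGraph.{u}) :
    GraphModules.M G = Submodule.span GraphModules.R
        (Set.range fun k : ℕ => GraphModules.countZ (GraphModules.D^[k] G)) ∧
      GraphModules.M G ≤ GraphModules.GraphsStar.{u} :=
  ⟨GraphModules.M_eq_spanZ G,
    (GraphModules.M_eq_spanZ G).le.trans (GraphModules.spanZ_le_GraphsStar G)⟩
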